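/- **Claim (The order/unstability lemma).** Conventions. A real is an element of the Baire space ${}^\omega\omega$. Let $\mathfrak A$ be a structure in a countable vocabulary whose universe is a set of reals. Formulas are formulas of $\mathbb L_{\omega_1,\omega}(\mathbf Q)$ in the vocabulary of $\mathfrak A$, where $\mathbf Q$ is the quantifier "there are uncountably many"; writing $\varphi=\varphi(\bar x)$ means that $\bar x$ is a finite sequence of distinct variables which includes all free variables of $\varphi$. The pair $(\mathfrak A,\Delta)$ is a *candidate* if the universe, the relations and the graphs of the functions of $\mathfrak A$ are $\Sigma^1_1$ (analytic), and $\Delta$ is a countable set of formulas with finitely many free variables such that for every $\varphi(\bar x)\in\Delta$ the set $\{\bar a:\mathfrak A\models\varphi[\bar a]\}$ is $\Sigma^1_1$. The pair $(\mathfrak A,\Delta)$ is *$\aleph_0$-unstable* if there are $m<\omega$, tuples $\bar a_\eta\in{}^m\mathfrak A$ for $\eta\in{}^\omega2$, and, for every $\nu\in{}^{\omega>}2$, formulas $\varphi_{\nu,0}(\bar x,\bar y_\nu),\varphi_{\nu,1}(\bar x,\bar y_\nu)\in\Delta$ with $\bar x$ of length $m$, and a tuple $\bar b_\nu$ from $\mathfrak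 A$ of the length of $\bar y_\nu$, such that (a) $\mathfrak A\models\neg(\exists\bar x)\,(\varphi_{\nu,0}(\bar x,\bar b_\nu)\wedge\varphi_{\nu,1}(\bar x,\bar b_\nu))$ for every $\nu\in{}^{\omega>}2$; (b) if $\nu$ is an initial segment of both $\eta_0,\eta_1\in{}^\omega2$, $n$ is the length of $\nu$, $\eta_0(n)=0$ and $\eta_1(n)=1$, then $\mathfrak A\models\varphi_{\nu,0}[\bar a_{\eta_0},\bar b_\nu]\wedge\varphi_{\nu,1}[\bar a_{\eta_1},\bar b_\nu]$. Assume that $(\mathfrak A,\Delta)$ is a candidate, that $m<\omega$ and $\varphi_0(\bar x,\bar y),\varphi_1(\bar x,\bar y)\in\Delta$, where $\bar x,\bar y$ have length $m$, are contradictory in $\mathfrak A$, i.e. $\mathfrak A\models\neg(\exists\bar x,\bar y)(\varphi_0(\bar x,\bar y)\wedge\varphi_1(\bar x,\bar y))$, that $J$ is a linear order, and that $\bar a_t\in{}^m\mathfrak A$ for $t\in J$ satisfy $$\mathfrak A\models\varphi_0[\bar a_s,\bar a_t]\wedge\varphi_1[\bar a_t,\bar a_s]\qquad\text{whenever } s<_Jt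 .$$ Assume moreover that $|J|\ge\aleph_{\omega_1}$, or that $J$ is uncountable and its density (the least cardinality of a dense set in the order topology) is $<|J|$. Then $(\mathfrak A,\Delta)$ is $\aleph_0$-unstable; more specifically, the demand in the definition of $\aleph_0$-unstable holds with this $m$ and with $\varphi_{\nu,0}(\bar x,\bar y_\nu)=\varphi_0(\bar x,\bar y)$ and $\varphi_{\nu,1}(\bar x,\bar y_\nu)=\varphi_1(\bar x,\bar y)$ for every $\nu\in{}^{\omega>}2$. -/

import Mathlib

open Cardinal Ordinal

universe u v w

/-- Formulas of the infinitary logic `L_{ω₁,ω}(Q)` over the vocabulary `L`, with variables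
named by natural numbers.  `conj` is the conjunction of a countable sequence of formulas, `exs x φ`
is `∃ x, φ`, and `exUnc x φ` is `Q x, φ`: "there are uncountably many `x` such that `φ`". -/
inductive InfFormula (L : FirstOrder.Language.{u, v}) : Type (max u v)
  | equal (s t : L.Term ℕ) : InfFormula L
  | rel {n : ℕ} (R : L.Relations n) (ts : Fin n → L.Term ℕ) : InfFormula L
  | neg (φ : InfFormula L) : InfFormula L
  | conj (φ : ℕ → InfFormula L) : InfFormula L
  | exs (x : ℕ) (φ : InfFormula L) : InfFormula L
  | exUnc (x : ℕ) (φ : InfFormula L) : InfFormula L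

namespace InfFormula

variable {L : FirstOrder.Language.{u, v}}

/-- The set of free variables of a formula. -/
def freeVars : InfFormula L → Set ℕ
  | equal s t => ↑s.varFinset ∪ ↑t.varFinset
  | rel _ ts => ⋃ i, ↑(ts i).varFinset
  | neg φ => φ.freeVars
  | conj φ => ⋃ i, (φ i).freeVars
  | exs x φ => φ.freeVars \ {x}
  | exUnc x φ => φ.freeVars \ {x}

/-- Satisfaction of a formula in the structure `A` under an assignment of the variables. -/
def Sat {A : Type w} [L.Structure A] : InfFormula L → (ℕ → A) → Prop
  | equal s t, val => s.realize val = t.realize val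
  | rel R ts, val => FirstOrder.Language.Structure.RelMap R fun i => (ts i).realize val
  | neg φ, val => ¬ φ.Sat val
  | conj φ, val => ∀ i, (φ i).Sat val
  | exs x φ, val => ∃ c : A, φ.Sat (Function.update val x c)
  | exUnc x φ, val => ¬ {c : A | φ.Sat (Function.update val x c)}.Countable

/-- `φ = φ(x₀, …, xₙ₋₁)`: the variables `xᵢ` are distinct and include the free variables
of `φ`. -/
def InVars (φ : InfFormula L) {n : ℕ} (x : Fin n → ℕ) : Prop :=
  Function.Injective x ∧ φ.freeVars ⊆ Set.range x

/-- `A ⊨ φ[a₀, …, aₙ₋₁]` for `φ = φ(x₀, …, xₙ₋₁)`: `φ` is satisfied when `aᵢ` is assigned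
to `xᵢ` (the values given to the other variables are irrelevant when `φ.InVars x`). -/
def Holds {A : Type w} [L.Structure A] (φ : InfFormula L) {n : ℕ} (x : Fin n → ℕ)
    (a : Fin n → A) : Prop :=
  ∃ val : ℕ → A, (∀ i, val (x i) = a i) ∧ φ.Sat val

end InfFormula

/-- The reals, in the sense of descriptive set theory: the Baire space `ω^ω`. -/
abbrev Reals : Type := ℕ → ℕ

/-- A set of `n`-tuples from a set `A` of reals is `Σ¹₁` when it is an analytic subset of the
space of all `n`-tuples of reals. -/
def IsSigmaOneOne {A : Set Reals} {n : ℕ} (S : Set (Fin n → A)) : Prop :=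
  MeasureTheory.AnalyticSet ((fun (a : Fin n → A) (i : Fin n) => (a i : Reals)) '' S)

/-- A structure whose universe is a set `A` of reals is a `Σ¹₁`-model when its universe, its
relations and the graphs of its functions are `Σ¹₁` (constants are functions of no variables). -/
structure IsSigmaOneOneModel (L : FirstOrder.Language.{u, v}) (A : Set Reals)
    [L.Structure A] : Prop where
  universe_analytic : MeasureTheory.AnalyticSet A
  rel_analytic : ∀ (n : ℕ) (R : L.Relations n),
    IsSigmaOneOne {a : Fin n → A | FirstOrder.Language.Structure.RelMap R a}
  fun_analytic : ∀ (n : ℕ) (f : L.Functions n),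
    IsSigmaOneOne {a : Fin (n + 1) → A |
      FirstOrder.Language.Structure.funMap f (fun i : Fin n => a i.castSucc) = a (Fin.last n)}

/-- `(A, Δ)` is a `Σ¹₁`-candidate: `A` is a `Σ¹₁`-model and `Δ` is a countable set of formulas
with finitely many free variables, each of which defines `Σ¹₁` sets in `A`. -/
structure IsCandidate {L : FirstOrder.Language.{u, v}} (A : Set Reals) [L.Structure A]
    (Δ : Set (InfFormula L)) : Prop where
  model : IsSigmaOneOneModel L A
  countable : Δ.Countable
  finite_freeVars : ∀ φ ∈ Δ, φ.freeVars.Finite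
  analytic : ∀ φ ∈ Δ, ∀ (n : ℕ) (x : Fin n → ℕ), φ.InVars x →
    IsSigmaOneOne {a : Fin n → A | φ.Holds x a}

/-- The formulas `φ₀(x̄, ȳ)` and `φ₁(x̄, ȳ)` are contradictory in `A`. -/
def Contradictory {L : FirstOrder.Language.{u, v}} (A : Set Reals) [L.Structure A]
    (φ₀ φ₁ : InfFormula L) {m k : ℕ} (x : Fin m → ℕ) (y : Fin k → ℕ) : Prop :=
  ¬ ∃ (a : Fin m → A) (b : Fin k → A),
    φ₀.Holds (Fin.append x y) (Fin.append a b) ∧ φ₁.Holds (Fin.append x y) (Fin.append a b)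

/-- The finite binary sequence `ν` is an initial segment of the infinite binary sequence `η`. -/
def IsInitialSegment (ν : List Bool) (η : ℕ → Bool) : Prop :=
  ∀ (i : ℕ) (h : i < ν.length), ν[i] = η i

/-- The data `φ_{ν,0}(x̄, ȳ_ν), φ_{ν,1}(x̄, ȳ_ν) ∈ Δ`, `b̄_ν` (for finite binary sequences `ν`)
and `ā_η` (for infinite binary sequences `η`) witness that `(A, Δ)` is `ℵ₀`-unstable. -/
structure WitnessesUnstable {L : FirstOrder.Language.{u, v}} (A : Set Reals) [L.Structure A]
    (Δ : Set (InfFormula L)) {m : ℕ} (x : Fin m → ℕ)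
    (k : List Bool → ℕ) (y : (ν : List Bool) → Fin (k ν) → ℕ)
    (φ₀ φ₁ : List Bool → InfFormula L)
    (b : (ν : List Bool) → Fin (k ν) → A) (a : (ℕ → Bool) → Fin m → A) : Prop where
  mem₀ : ∀ ν, φ₀ ν ∈ Δ
  mem₁ : ∀ ν, φ₁ ν ∈ Δ
  inVars₀ : ∀ ν, (φ₀ ν).InVars (Fin.append x (y ν))
  inVars₁ : ∀ ν, (φ₁ ν).InVars (Fin.append x (y ν))
  contradictory : ∀ ν, ¬ ∃ c : Fin m → A,
    (φ₀ ν).Holds (Fin.append x (y ν)) (Fin.append c (b ν)) ∧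
      (φ₁ ν).Holds (Fin.append x (y ν)) (Fin.append c (b ν))
  split : ∀ (ν : List Bool) (η₀ η₁ : ℕ → Bool),
    IsInitialSegment ν η₀ → IsInitialSegment ν η₁ →
    η₀ ν.length = false → η₁ ν.length = true →
    (φ₀ ν).Holds (Fin.append x (y ν)) (Fin.append (a η₀) (b ν)) ∧
      (φ₁ ν).Holds (Fin.append x (y ν)) (Fin.append (a η₁) (b ν))

/-- `(A, Δ)` is `ℵ₀`-unstable. -/
def IsAlephZeroUnstable {L : FirstOrder.Language.{u, v}} (A : Set Reals) [L.Structure A]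
    (Δ : Set (InfFormula L)) : Prop :=
  ∃ (m : ℕ) (x : Fin m → ℕ) (k : List Bool → ℕ) (y : (ν : List Bool) → Fin (k ν) → ℕ)
    (φ₀ φ₁ : List Bool → InfFormula L)
    (b : (ν : List Bool) → Fin (k ν) → A) (a : (ℕ → Bool) → Fin m → A),
    WitnessesUnstable A Δ x k y φ₀ φ₁ b a

/-- The density of a linear order: the least cardinality of a set which is dense in the order
topology. -/
noncomputable def orderDensity (J : Type w) [LinearOrder J] : Cardinal.{w} :=
  sInf {κ | ∃ D : Set J, @Dense J (Preorder.topology J) D ∧ #D = κ}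

/-! The sets defined by `φ₀` and `φ₁` are continuous images of the Baire space, under `f₀` and `f₁`.
Each pair `t ≠ d` in `J` gets a code `w t d` sent to `(a t, a d)`, by `f₀` if `t < d` and by `f₁` if
`d < t`. The stream `z t d` records the digits of the code and of both tuples. It suffices to find
finite binary trees of points of `J`, one per level, with elements sided by their branches and with
streams that stabilise digit by digit. The elements of `J` may change from level to level: the
streams converge, and by continuity their limits still code pairs in the right set.

The trees come from a splitting rank. Large sets split at a point into two large sets
(`exists_split_of_succ_lt`, `exists_split_of_dense`), so few elements have rank below a given
countable ordinal (`mk_not_splitRank_le`) and all countable ranks occur. A level realized at all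
countable ranks extends to such a level (`LevelExtendible.exists_next`), as only countably many
patterns of digits compete for `ω₁` ranks. -/

/-! ### Splitting rank and coherent trees. -/

section Combinatorics

variable {J : Type w} [LinearOrder J] {C : Type*}

/-- `t` and `t'` lie on the same side of `d`, and the streams `z t d` and `z t' d` agree up
to `k`. -/
def Sim (z : J → J → ℕ → C) (k : ℕ) (t t' d : J) : Prop :=
  (t < d ↔ t' < d) ∧ (d < t ↔ d < t') ∧ ∀ i < k, z t d i = z t' d i

/-- The splitting rank of `t` over `D` is at least `α`: for every `β < α` and every precision `k`,
some point separates two elements which resemble `t` over `D` up to `k`, and which have rank at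
least `β` over `D` together with that point. -/
def SplitRank (z : J → J → ℕ → C) (α : Ordinal.{w}) (D : Set J) (t : J) : Prop :=
  ∀ β < α, ∀ k : ℕ, ∃ t₀ d t₁, t₀ < d ∧ d < t₁ ∧ (∀ e ∈ D, Sim z k t t₀ e) ∧
    (∀ e ∈ D, Sim z k t t₁ e) ∧ SplitRank z β (insert d D) t₀ ∧ SplitRank z β (insert d D) t₁
termination_by α

theorem SplitRank.mono {z : J → J → ℕ → C} {α β : Ordinal.{w}} (h : β ≤ α) {D : Set J} {t : J}
    (ht : SplitRank z α D t) : SplitRank z β D t := by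
  rw [SplitRank] at ht ⊢
  exact fun γ hγ => ht γ (hγ.trans_le h)

theorem Cardinal.mk_iUnion_le_of_countable {ι : Type*} [Countable ι] {X : Type w} {f : ι → Set X}
    {κ : Cardinal.{w}} (hκ : ℵ₀ ≤ κ) (hf : ∀ i, #(f i) ≤ κ) : #(⋃ i, f i) ≤ κ := by
  rcases isEmpty_or_nonempty ι with h | h
  · simp
  obtain ⟨g, hg⟩ := exists_surjective_nat ι
  rw [← hg.iUnion_comp]
  have := mk_iUnion_le_lift (fun n => f (g n))
  simp only [lift_uzero, mk_nat, lift_aleph0] at this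
  refine this.trans ?_
  refine (mul_le_mul' hκ (ciSup_le' fun i => ?_)).trans (mul_eq_self hκ).le
  exact hf _

theorem countable_Iio_of_lt_omega_one {α : Ordinal.{w}} (h : α < ω_ 1) :
    Countable (Set.Iio α) := by
  rw [← mk_le_aleph0_iff, Cardinal.mk_Iio_ordinal, Cardinal.lift_le_aleph0]
  rwa [← Order.lt_succ_iff, Cardinal.succ_aleph0, ← lt_ord, ord_aleph]

/-- The set of elements of rank less than `α` is small, if large sets can be split into two
large sets by a point. -/
theorem mk_not_splitRank_le [Countable C] (z : J → J → ℕ → C) (κ : Ordinal.{w} → Cardinal.{w})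
    (hκ : ∀ α, ℵ₀ ≤ κ α)
    (hsplit : ∀ α < ω_ 1, ∀ β < α, ∀ S : Set J, κ α < #S →
      ∃ d, κ β < #(S ∩ Set.Iio d : Set J) ∧ κ β < #(S ∩ Set.Ioi d : Set J))
    (α : Ordinal.{w}) (hα : α < ω_ 1) (D : Set J) (hD : D.Finite) :
    #{t | ¬ SplitRank z α D t} ≤ κ α := by
  induction α using WellFoundedLT.induction generalizing D with
  | ind α ih =>
  have := hD.to_subtype
  have := countable_Iio_of_lt_omega_one hα
  let cls (k : ℕ) (t : J) : D → Prop × Prop × (Fin k → C) :=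
    fun e => (t < e, e.1 < t, fun i => z t e i)
  have hcls : ∀ k t t', cls k t = cls k t' → ∀ e ∈ D, Sim z k t t' e := by
    intro k t t' h e he
    have h := congrFun h ⟨e, he⟩
    simp only [cls, Prod.mk.injEq, eq_iff_iff] at h
    exact ⟨h.1, h.2.1, fun i hi => congrFun h.2.2 ⟨i, hi⟩⟩
  -- A failure of rank `α` is witnessed by some `β < α`, a precision and a class over `D`. There are
  -- countably many such triples, so it is enough to bound each piece.
  let bad (p : Σ (_ : Set.Iio α) (k : ℕ), D → Prop × Prop × (Fin k → C)) : Set J :=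
    {t | cls p.2.1 t = p.2.2 ∧ ¬ ∃ t₀ d t₁, t₀ < d ∧ d < t₁ ∧ (∀ e ∈ D, Sim z p.2.1 t t₀ e) ∧
      (∀ e ∈ D, Sim z p.2.1 t t₁ e) ∧ SplitRank z p.1 (insert d D) t₀ ∧
      SplitRank z p.1 (insert d D) t₁}
  have hsub : {t | ¬ SplitRank z α D t} ⊆ ⋃ p, bad p := by
    intro t ht
    rw [Set.mem_ofPred_eq, SplitRank] at ht
    push Not at ht
    obtain ⟨β, hβ, k, h⟩ := ht
    refine Set.mem_iUnion.2 ⟨⟨⟨β, hβ⟩, k, cls k t⟩, rfl, ?_⟩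
    push Not
    exact h
  refine (mk_le_mk_of_subset hsub).trans (mk_iUnion_le_of_countable (hκ α) ?_)
  rintro ⟨⟨β, hβ⟩, k, c⟩
  by_contra! hlt
  -- Each half of a large piece contains an element of rank `β` over `insert d D`, by induction.
  -- Both lie in the class of the piece, so the piece was not bad.
  obtain ⟨d, h₀, h₁⟩ := hsplit α hα β hβ _ hlt
  have key : ∀ U : Set J, κ β < #U → ∃ t ∈ U, SplitRank z β (insert d D) t := by
    intro U hU
    by_contra! h
    exact hU.not_ge ((mk_le_mk_of_subset h).trans
      (ih β hβ ((Set.mem_Iio.1 hβ).trans hα) _ (hD.insert d)))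
  obtain ⟨t₀, ⟨⟨ht₀, hn⟩, hd₀⟩, hr₀⟩ := key _ h₀
  obtain ⟨t₁, ⟨⟨ht₁, -⟩, hd₁⟩, hr₁⟩ := key _ h₁
  exact hn ⟨t₀, d, t₁, hd₀, hd₁, hcls _ _ _ rfl, hcls _ _ _ (ht₀.trans ht₁.symm), hr₀, hr₁⟩

/-- Otherwise every fiber is bounded below `ω₁`, and so is the supremum of the countably many
bounds; the value of `g` there is contradictory. -/
theorem exists_unbounded_fiber {E : Type*} [Countable E] (g : Ordinal.{w} → E) :
    ∃ α₀ < ω_ 1, ∀ β < ω_ 1, ∃ α < ω_ 1, β ≤ α ∧ g α = g α₀ := by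
  by_contra! h
  have h0 : (0 : Ordinal.{w}) < ω_ 1 := omega_pos 1
  have : ∀ e : E, ∃ β < ω_ 1, ∀ α < ω_ 1, β ≤ α → g α ≠ e := by
    intro e
    by_cases he : ∃ α₀ < ω_ 1, g α₀ = e
    · obtain ⟨α₀, hα₀, rfl⟩ := he
      exact h α₀ hα₀
    · exact ⟨0, h0, fun α hα _ h => he ⟨α, hα, h⟩⟩
  choose b hb hb' using this
  have : Small.{w} E := Countable.toSmall E
  exact hb' _ _ (Ordinal.iSup_lt_omega_one hb) (Ordinal.le_iSup b _) rfl

open PiNat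

/-- The points of the tree `d` on the branch `η` below level `n`. -/
def branchPoints (d : List Bool → J) (η : ℕ → Bool) (n : ℕ) : Set J :=
  (fun j => d (res η j)) '' Set.Iio n

/-- The elements `t` of level `n` have splitting rank at least `α` over the points of `d` on
their branches. -/
def LevelRank (z : J → J → ℕ → C) (n : ℕ) (α : Ordinal.{w}) (S : (List Bool → J) × (List Bool → J)) :
    Prop :=
  ∀ η, SplitRank z α (branchPoints S.2 η n) (S.1 (res η n))

/-- The elements of level `n` lie on the side of the points below prescribed by their branches. -/
def LevelSided (n : ℕ) (S : (List Bool → J) × (List Bool → J)) : Prop :=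
  ∀ η, ∀ j < n, (η j = false → S.1 (res η n) < S.2 (res η j)) ∧
    (η j = true → S.2 (res η j) < S.1 (res η n))

/-- The elements of level `n` of `S` and of level `n'` of `S'` agree on the first `n` points, up
to precision `n`. -/
def LevelAgree (z : J → J → ℕ → C) (n n' : ℕ) (S S' : (List Bool → J) × (List Bool → J)) : Prop :=
  ∀ η, ∀ j < n, ∀ i < n,
    z (S.1 (res η n)) (S.2 (res η j)) i = z (S'.1 (res η n')) (S'.2 (res η j)) i

/-- The rank at each node gives a separating point, placed at that node, and two elements that
replace the old one at the successors. `Sim` carries over the sides and the first `n` digits. -/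
theorem exists_next_level {z : J → J → ℕ → C} {n : ℕ} {α : Ordinal.{w}}
    {S : (List Bool → J) × (List Bool → J)} (hr : LevelRank z n (Order.succ α) S)
    (hs : LevelSided n S) :
    ∃ S', LevelRank z (n + 1) α S' ∧ LevelSided (n + 1) S' ∧ LevelAgree z n (n + 1) S S' := by
  have key : ∀ l : List Bool, ∃ p : J × J × J, ∀ η, res η n = l →
      p.1 < p.2.1 ∧ p.2.1 < p.2.2 ∧
      (∀ e ∈ branchPoints S.2 η n, Sim z n (S.1 l) p.1 e) ∧
      (∀ e ∈ branchPoints S.2 η n, Sim z n (S.1 l) p.2.2 e) ∧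
      SplitRank z α (insert p.2.1 (branchPoints S.2 η n)) p.1 ∧
      SplitRank z α (insert p.2.1 (branchPoints S.2 η n)) p.2.2 := by
    intro l
    by_cases h : ∃ η, res η n = l
    · obtain ⟨η, rfl⟩ := h
      have h := hr η
      rw [SplitRank] at h
      obtain ⟨t₀, d, t₁, h⟩ := h α (Order.lt_succ α) n
      refine ⟨(t₀, d, t₁), fun η' hη' => ?_⟩
      have : branchPoints S.2 η' n = branchPoints S.2 η n := by
        refine Set.image_congr fun j hj => ?_
        rw [res_eq_res.2 fun i hi => res_eq_res.1 hη' (hi.trans hj)]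
      rw [this]
      exact h
    · exact ⟨(S.1 l, S.1 l, S.1 l), fun η hη => (h ⟨η, hη⟩).elim⟩
  choose p hp using key
  -- `res` lists the latest digit first: the head is the last turn and the tail is the parent node.
  let S' : (List Bool → J) × (List Bool → J) :=
    (fun l => if l.head? = some true then (p l.tail).2.2 else (p l.tail).1,
      fun l => if l.length = n then (p l).2.1 else S.2 l)
  have hd : ∀ η, ∀ j < n, S'.2 (res η j) = S.2 (res η j) := fun η j hj => by
    simp [S', hj.ne]
  have hd' : ∀ η, S'.2 (res η n) = (p (res η n)).2.1 := fun η => by simp [S']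
  have hb : ∀ η, branchPoints S'.2 η (n + 1) =
      insert (p (res η n)).2.1 (branchPoints S.2 η n) := fun η => by
    rw [branchPoints, ← Order.succ_eq_add_one, Order.Iio_succ_eq_insert, Set.image_insert_eq, hd']
    congr 1
    exact Set.image_congr fun j hj => hd η j hj
  have ht : ∀ η, (η n = true ∧ S'.1 (res η (n + 1)) = (p (res η n)).2.2) ∨
      (η n = false ∧ S'.1 (res η (n + 1)) = (p (res η n)).1) := fun η => by
    cases h : η n <;> simp [S', h]
  have hsim : ∀ η, ∀ j < n, Sim z n (S.1 (res η n)) (S'.1 (res η (n + 1))) (S.2 (res η j)) := by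
    intro η j hj
    have hmem : S.2 (res η j) ∈ branchPoints S.2 η n := ⟨j, hj, rfl⟩
    rcases ht η with ⟨-, h⟩ | ⟨-, h⟩ <;> rw [h]
    · exact (hp _ η rfl).2.2.2.1 _ hmem
    · exact (hp _ η rfl).2.2.1 _ hmem
  refine ⟨S', fun η => ?_, fun η j hj => ?_, fun η j hj i hi => ?_⟩
  · rw [hb]
    rcases ht η with ⟨-, h⟩ | ⟨-, h⟩ <;> rw [h]
    · exact (hp _ η rfl).2.2.2.2.2
    · exact (hp _ η rfl).2.2.2.2.1
  · rcases Nat.lt_succ_iff_lt_or_eq.1 hj with hj | rfl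
    · rw [hd η j hj, ← (hsim η j hj).1, ← (hsim η j hj).2.1]
      exact hs η j hj
    · rw [hd']
      rcases ht η with ⟨h', h⟩ | ⟨h', h⟩ <;> rw [h, h']
      · simpa using (hp _ η rfl).2.1
      · simpa using (hp _ η rfl).1
  · rw [hd η j hj]
    exact (hsim η j hj).2.2 i hi

/-- Up to agreement at level `n`, the approximation `S` is realized at all countable ranks. -/
def LevelExtendible (z : J → J → ℕ → C) (n : ℕ) (S : (List Bool → J) × (List Bool → J)) : Prop :=
  ∀ α < ω_ 1, ∃ S', LevelRank z n α S' ∧ LevelSided n S' ∧ LevelAgree z n n S S'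

/-- Extend a realization of rank `α + 1` for every `α < ω₁`. The relevant digits form a finite array
over `C`, so one array occurs for unboundedly many `α`, and monotonicity of rank covers the rest. -/
theorem LevelExtendible.exists_next [Countable C] {z : J → J → ℕ → C} {n : ℕ}
    {S : (List Bool → J) × (List Bool → J)} (h : LevelExtendible z n S) :
    ∃ S', LevelExtendible z (n + 1) S' ∧ LevelSided (n + 1) S' ∧ LevelAgree z n (n + 1) S S' := by
  have key : ∀ α : Ordinal.{w}, ∃ S', α < ω_ 1 → LevelRank z (n + 1) α S' ∧
      LevelSided (n + 1) S' ∧ LevelAgree z n (n + 1) S S' := by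
    intro α
    by_cases hα : α < ω_ 1
    · obtain ⟨T, hT, hT', hT''⟩ := h (Order.succ α) ((isSuccLimit_omega 1).succ_lt hα)
      obtain ⟨S', h₁, h₂, h₃⟩ := exists_next_level hT hT'
      exact ⟨S', fun _ => ⟨h₁, h₂, fun η j hj i hi =>
        (hT'' η j hj i hi).trans (h₃ η j hj i hi)⟩⟩
    · exact ⟨S, fun h => (hα h).elim⟩
  choose T hT using key
  let pad (s : Fin (n + 1) → Bool) (k : ℕ) : Bool := if hk : k < n + 1 then s ⟨k, hk⟩ else false
  let τ (S : (List Bool → J) × (List Bool → J)) (s : Fin (n + 1) → Bool) (j i : Fin (n + 1)) : C :=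
    z (S.1 (res (pad s) (n + 1))) (S.2 (res (pad s) j)) i
  have hτ : ∀ S S', τ S = τ S' → LevelAgree z (n + 1) (n + 1) S S' := by
    intro S S' h η j hj i hi
    have h := congrFun (congrFun (congrFun h fun k => η k) ⟨j, hj⟩) ⟨i, hi⟩
    have hpad : ∀ k ≤ n + 1, res (pad fun k => η k) k = res η k := fun k hk =>
      res_eq_res.2 fun i hi => dif_pos (hi.trans_le hk)
    simpa only [τ, hpad _ hj.le, hpad _ le_rfl] using h
  obtain ⟨α₀, hα₀, hub⟩ := exists_unbounded_fiber fun α => τ (T α)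
  refine ⟨T α₀, fun β hβ => ?_, (hT α₀ hα₀).2⟩
  obtain ⟨α, hα, hβα, h⟩ := hub β hβ
  exact ⟨T α, fun η => ((hT α hα).1 η).mono hβα, (hT α hα).2.1, hτ _ _ h.symm⟩

/-- If all countable splitting ranks are attained, there is a perfect tree of approximations,
coherent on longer and longer initial segments of the streams. -/
theorem exists_coherent_levels [Countable C] (z : J → J → ℕ → C)
    (h : ∀ α < ω_ 1, ∃ t, SplitRank z α ∅ t) :
    ∃ S : ℕ → (List Bool → J) × (List Bool → J), (∀ n, LevelSided n (S n)) ∧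
      ∀ m n, m ≤ n → LevelAgree z m n (S m) (S n) := by
  obtain ⟨t, -⟩ := h 0 (omega_pos 1)
  have h0 : LevelExtendible z 0 (fun _ => t, fun _ => t) := by
    intro α hα
    obtain ⟨s, hs⟩ := h α hα
    exact ⟨(fun _ => s, fun _ => s), fun η => by simpa [branchPoints] using hs,
      fun η j hj => (Nat.not_lt_zero _ hj).elim, fun η j hj => (Nat.not_lt_zero _ hj).elim⟩
  let S' (n : ℕ) : {S // LevelExtendible z n S} :=
    Nat.rec ⟨_, h0⟩ (fun _ S => ⟨_, S.2.exists_next.choose_spec.1⟩) n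
  have hS : ∀ n, LevelSided (n + 1) (S' (n + 1)).1 ∧
      LevelAgree z n (n + 1) (S' n).1 (S' (n + 1)).1 := fun n =>
    (S' n).2.exists_next.choose_spec.2
  refine ⟨fun n => (S' n).1, fun n => ?_, fun m n hmn => ?_⟩
  · cases n with
    | zero => exact fun η j hj => (Nat.not_lt_zero _ hj).elim
    | succ n => exact (hS n).1
  · induction n, hmn using Nat.le_induction with
    | base => exact fun η j _ i _ => rfl
    | succ n hmn ih =>
      exact fun η j hj i hi => (ih η j hj i hi).trans
        ((hS n).2 η j (hj.trans_le hmn) i (hi.trans_le hmn))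

end Combinatorics

/-! ### Splitting large subsets of a linear order. -/

section Splitting

variable {J : Type w} [LinearOrder J]

/-- In a larger `U`, take a subset `T` of size `μ⁺`. If `T` lies strictly below a point of `U`, it
has size at most `μ`; otherwise it is cofinal, and `μ⁺` initial segments of size at most `μ` cover
`U` up to `T`. -/
theorem mk_le_succ_of_mk_inter_Iio_le {μ : Cardinal.{w}} (hμ : ℵ₀ ≤ μ) {U : Set J}
    (h : ∀ d ∈ U, #(U ∩ Set.Iio d : Set J) ≤ μ) : #U ≤ Order.succ μ := by
  by_contra! hlt
  obtain ⟨T, hTU, hT⟩ := le_mk_iff_exists_subset.1 hlt.le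
  by_cases hs : ∃ s ∈ U, ∀ t ∈ T, t < s
  · obtain ⟨s, hs, hts⟩ := hs
    have : #T ≤ μ :=
      (mk_le_mk_of_subset fun t ht => Set.mem_inter (hTU ht) (hts t ht)).trans (h s hs)
    rw [hT] at this
    exact (Order.lt_succ μ).not_ge this
  · push Not at hs
    have hsub : U ⊆ T ∪ ⋃ t ∈ T, U ∩ Set.Iio t := by
      intro s hsU
      obtain ⟨t, ht, hst⟩ := hs s hsU
      rcases hst.eq_or_lt with rfl | hst
      · exact Or.inl ht
      · exact Or.inr (Set.mem_biUnion ht ⟨hsU, hst⟩)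
    have hinf : ℵ₀ ≤ Order.succ μ := hμ.trans (Order.le_succ μ)
    have hun : #(⋃ t ∈ T, U ∩ Set.Iio t : Set J) ≤ Order.succ μ := by
      refine (mk_biUnion_le _ _).trans ?_
      rw [hT]
      exact (mul_le_mul_right (ciSup_le' fun t => (h _ (hTU t.2)).trans (Order.le_succ μ)) _).trans
        (mul_eq_self hinf).le
    refine hlt.not_ge ((mk_le_mk_of_subset hsub).trans ((mk_union_le _ _).trans ?_))
    exact (add_le_add hT.le hun).trans (add_eq_self hinf).le

/-- If no point splits `S`, every point of `S` has a small side; the previous lemma and its dual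
bound the two kinds of points. -/
theorem exists_split_of_succ_lt {μ : Cardinal.{w}} (hμ : ℵ₀ ≤ μ) {S : Set J}
    (hS : Order.succ μ < #S) :
    ∃ d, μ < #(S ∩ Set.Iio d : Set J) ∧ μ < #(S ∩ Set.Ioi d : Set J) := by
  by_contra! h
  let U : Set J := {d ∈ S | #(S ∩ Set.Iio d : Set J) ≤ μ}
  let V : Set J := {d ∈ S | #(S ∩ Set.Ioi d : Set J) ≤ μ}
  have hU : #U ≤ Order.succ μ := mk_le_succ_of_mk_inter_Iio_le hμ fun d hd =>
    (mk_le_mk_of_subset (Set.inter_subset_inter_left _ fun _ h => h.1)).trans hd.2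
  have hV : #V ≤ Order.succ μ :=
    mk_le_succ_of_mk_inter_Iio_le (J := Jᵒᵈ) (U := V) hμ fun d hd =>
      (mk_le_mk_of_subset (Set.inter_subset_inter_left _ fun _ h => h.1)).trans hd.2
  have hSUV : S ⊆ U ∪ V := fun d hd => by
    rcases le_or_gt #(S ∩ Set.Iio d : Set J) μ with h' | h'
    · exact Or.inl ⟨hd, h'⟩
    · exact Or.inr ⟨hd, h d h'⟩
  refine hS.not_ge ((mk_le_mk_of_subset hSUV).trans ((mk_union_le _ _).trans ?_))
  exact (add_le_add hU hV).trans (add_eq_self (hμ.trans (Order.le_succ μ))).le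

/-- If no point splits `S`, discard `D` and a small side of each `d ∈ D`, at most `μ` elements in
all. Three survivors would have a point of `D` between the outer two, one of which lies on its
discarded side. -/
theorem exists_split_of_dense {μ : Cardinal.{w}} (hμ : ℵ₀ ≤ μ) {D : Set J} (hD : #D ≤ μ)
    (hdense : ∀ s t u : J, s < t → t < u → ∃ d ∈ D, s < d ∧ d < u) {S : Set J} (hS : μ < #S) :
    ∃ d, μ < #(S ∩ Set.Iio d : Set J) ∧ μ < #(S ∩ Set.Ioi d : Set J) := by
  by_contra! h
  let W : Set J := ⋃ d : D, {s ∈ S | s ≠ d.1 ∧ (#(S ∩ Set.Iio d.1 : Set J) ≤ μ → s < d.1) ∧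
    (¬ #(S ∩ Set.Iio d.1 : Set J) ≤ μ → d.1 < s)}
  have hW : #W ≤ μ := by
    refine (mk_iUnion_le _).trans ((mul_le_mul' hD (ciSup_le' fun d => ?_)).trans
      (mul_eq_self hμ).le)
    by_cases hd : #(S ∩ Set.Iio d.1 : Set J) ≤ μ
    · exact (mk_le_mk_of_subset fun s hs => Set.mem_inter hs.1 (hs.2.2.1 hd)).trans hd
    · exact (mk_le_mk_of_subset fun s hs => Set.mem_inter hs.1 (hs.2.2.2 hd)).trans
         (h _ (not_le.1 hd))
  let R : Set J := S \ (W ∪ D)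
  have hR : ∀ s ∈ R, ∀ t ∈ R, ∀ u ∈ R, s < t → t < u → False := by
    intro s hs t ht u hu hst htu
    obtain ⟨d, hd, hsd, hdu⟩ := hdense s t u hst htu
    by_cases hdμ : #(S ∩ Set.Iio d : Set J) ≤ μ
    · exact hs.2 (Or.inl (Set.mem_iUnion.2 ⟨⟨d, hd⟩, hs.1, hsd.ne, fun _ => hsd,
        fun h => (h hdμ).elim⟩))
    · exact hu.2 (Or.inl (Set.mem_iUnion.2 ⟨⟨d, hd⟩, hu.1, hdu.ne', fun h => (hdμ h).elim,
        fun _ => hdu⟩))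
  have hRfin : #R ≤ μ := by
    refine le_trans ?_ hμ
    by_contra! hinf
    have hinf : R.Infinite := fun hf => hinf.not_ge (hf.countable.le_aleph0)
    obtain ⟨T, hTR, hT⟩ := hinf.exists_subset_card_eq 3
    let f := T.orderEmbOfFin hT
    have hf : ∀ i, f i ∈ R := fun i => hTR (T.orderEmbOfFin_mem hT i)
    exact hR _ (hf 0) _ (hf 1) _ (hf 2) (f.lt_iff_lt.2 (by decide)) (f.lt_iff_lt.2 (by decide))
  have hsub : S ⊆ (W ∪ D) ∪ R := fun s hs => by
    by_cases h' : s ∈ W ∪ D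
    · exact Or.inl h'
    · exact Or.inr ⟨hs, h'⟩
  refine hS.not_ge ((mk_le_mk_of_subset hsub).trans ((mk_union_le _ _).trans ?_))
  refine (add_le_add ((mk_union_le _ _).trans (add_le_add hW hD)) hRfin).trans ?_
  rw [add_eq_self hμ, add_eq_self hμ]

/-- In a linear order as in the order lemma, all countable splitting ranks are attained. -/
theorem exists_splitRank {C : Type*} [Countable C]
    (hJ : ℵ_ (ω_ 1) ≤ #J ∨ (ℵ₀ < #J ∧ orderDensity J < #J)) (z : J → J → ℕ → C)
    (α : Ordinal.{w}) (hα : α < ω_ 1) : ∃ t, SplitRank z α ∅ t := by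
  suffices h : ∃ κ : Ordinal.{w} → Cardinal.{w}, (∀ α, ℵ₀ ≤ κ α) ∧ (∀ α < ω_ 1, κ α < #J) ∧
      ∀ α < ω_ 1, ∀ β < α, ∀ S : Set J, κ α < #S →
        ∃ d, κ β < #(S ∩ Set.Iio d : Set J) ∧ κ β < #(S ∩ Set.Ioi d : Set J) by
    obtain ⟨κ, hκ, hκJ, hsplit⟩ := h
    by_contra! h
    have := mk_not_splitRank_le z κ hκ hsplit α hα ∅ Set.finite_empty
    rw [Set.eq_univ_of_forall (s := {t | ¬ SplitRank z α ∅ t}) h, mk_univ] at this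
    exact (hκJ α hα).not_ge this
  rcases hJ with hJ | ⟨hJ, hdens⟩
  -- Splitting costs one cardinal successor, and `ℵ_ β` has successor at most `ℵ_ α` for `β < α`. In
  -- the density case below nothing is lost, so a constant threshold works.
  · refine ⟨fun α => ℵ_ α, fun α => aleph0_le_aleph α,
      fun α hα => (aleph_lt_aleph.2 hα).trans_le hJ, fun α _ β hβ S hS => ?_⟩
    refine exists_split_of_succ_lt (aleph0_le_aleph β) (lt_of_le_of_lt ?_ hS)
    rw [succ_aleph, ← Order.succ_eq_add_one]
    exact aleph_le_aleph.2 (Order.succ_le_of_lt hβ)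
  · let : TopologicalSpace J := Preorder.topology J
    have : OrderTopology J := ⟨rfl⟩
    obtain ⟨D, hD, hDcard⟩ : orderDensity J ∈ {κ | ∃ D : Set J, Dense D ∧ #D = κ} :=
      csInf_mem ⟨_, Set.univ, dense_univ, rfl⟩
    refine ⟨fun _ => max ℵ₀ (orderDensity J), fun _ => le_max_left _ _,
      fun _ _ => max_lt hJ hdens, fun α _ β _ S hS => ?_⟩
    refine exists_split_of_dense (le_max_left _ _) (hDcard.le.trans (le_max_right _ _)) ?_ hS
    intro s t u hst htu
    obtain ⟨d, ⟨h₁, h₂⟩, hd⟩ := hD.inter_open_nonempty _ (isOpen_Ioo (a := s) (b := u))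
      ⟨t, hst, htu⟩
    exact ⟨d, hd, h₁, h₂⟩

end Splitting

/-! ### Limits along branches. -/

section Branches

open PiNat Filter Topology

variable {J : Type w} [LinearOrder J] {m : ℕ}

theorem exists_branches {f₀ f₁ : (ℕ → ℕ) → Fin (m + m) → Reals} (hf₀ : Continuous f₀)
    (hf₁ : Continuous f₁) (a : J → Fin m → Reals)
    (hord : ∀ s t, s < t → Fin.append (a s) (a t) ∈ Set.range f₀ ∧
      Fin.append (a t) (a s) ∈ Set.range f₁)
    (hrank : ∀ z : J → J → ℕ → ℕ × (Fin m → ℕ) × (Fin m → ℕ), ∀ α < ω_ 1,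
      ∃ t, SplitRank z α ∅ t) :
    ∃ (b : List Bool → Fin m → Reals) (c : (ℕ → Bool) → Fin m → Reals), ∀ η j,
      (η j = false → Fin.append (c η) (b (res η j)) ∈ Set.range f₀) ∧
      (η j = true → Fin.append (c η) (b (res η j)) ∈ Set.range f₁) := by
  have hw : ∀ t d, ∃ w, (t < d → f₀ w = Fin.append (a t) (a d)) ∧
      (d < t → f₁ w = Fin.append (a t) (a d)) := by
    intro t d
    rcases lt_trichotomy t d with h | rfl | h
    · obtain ⟨w, hw⟩ := (hord t d h).1
      exact ⟨w, fun _ => hw, fun h' => (h.asymm h').elim⟩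
    · exact ⟨0, fun h => (lt_irrefl _ h).elim, fun h => (lt_irrefl _ h).elim⟩
    · obtain ⟨w, hw⟩ := (hord d t h).2
      exact ⟨w, fun h' => (h.asymm h').elim, fun _ => hw⟩
  choose w hw₀ hw₁ using hw
  obtain ⟨S, hside, hagree⟩ := exists_coherent_levels
    (fun t d i => (w t d i, (fun p => a t p i), fun p => a d p i)) (hrank _)
  have hlim : ∀ η j i n, i < n → j < n →
      w ((S n).1 (res η n)) ((S n).2 (res η j)) i = w ((S (max i j + 1)).1 (res η (max i j + 1)))
        ((S (max i j + 1)).2 (res η j)) i ∧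
      (∀ p, a ((S n).1 (res η n)) p i = a ((S (i + 1)).1 (res η (i + 1))) p i) ∧
      ∀ p, a ((S n).2 (res η j)) p i = a ((S (max i j + 1)).2 (res η j)) p i := by
    intro η j i n hi hj
    have h₁ := hagree (max i j + 1) n (max_lt hi hj) η j (by omega) i (by omega)
    -- The digits of `a t` are read from the stream at the root point, so that the limit along `η`
    -- does not depend on `j`.
    have h₂ := hagree (i + 1) n hi η 0 (by omega) i (by omega)
    simp only [Prod.mk.injEq, funext_iff] at h₁ h₂
    exact ⟨h₁.1.symm, fun p => (h₂.2.1 p).symm, fun p => (h₁.2.2 p).symm⟩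
  refine ⟨fun l p i => a ((S (max i l.length + 1)).2 l) p i,
    fun η p i => a ((S (i + 1)).1 (res η (i + 1))) p i, fun η j => ?_⟩
  have hA : Tendsto (fun n => Fin.append (a ((S n).1 (res η n))) (a ((S n).2 (res η j)))) atTop
      (𝓝 (Fin.append (fun p i => a ((S (i + 1)).1 (res η (i + 1))) p i)
        fun p i => a ((S (max i (res η j).length + 1)).2 (res η j)) p i)) := by
    refine tendsto_pi_nhds.2 fun q => tendsto_pi_nhds.2 fun i =>
      tendsto_atTop_of_eventually_const (i₀ := max i j + 1) fun n hn => ?_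
    have h := hlim η j i n (by omega) (by omega)
    refine Fin.addCases (fun p => ?_) (fun p => ?_) q
    · simpa only [Fin.append_left] using h.2.1 p
    · simpa only [Fin.append_right, res_length] using h.2.2 p
  have hW : Tendsto (fun n => w ((S n).1 (res η n)) ((S n).2 (res η j))) atTop
      (𝓝 fun i => w ((S (max i j + 1)).1 (res η (max i j + 1)))
        ((S (max i j + 1)).2 (res η j)) i) :=
    tendsto_pi_nhds.2 fun i => tendsto_atTop_of_eventually_const (i₀ := max i j + 1)
      fun n hn => (hlim η j i n (by omega) (by omega)).1
  constructor <;> intro hη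
  -- Past level `j` the codes map to the pairs under `f₀`, so by continuity the limit code maps to
  -- the limit pair.
  · refine ⟨_, tendsto_nhds_unique ((hf₀.tendsto _).comp hW) (hA.congr' ?_)⟩
    filter_upwards [eventually_gt_atTop j] with n hn
    exact (hw₀ _ _ ((hside n η j hn).1 hη)).symm
  · refine ⟨_, tendsto_nhds_unique ((hf₁.tendsto _).comp hW) (hA.congr' ?_)⟩
    filter_upwards [eventually_gt_atTop j] with n hn
    exact (hw₁ _ _ ((hside n η j hn).2 hη)).symm

end Branches

/-! ### Back to the structure. -/

theorem IsSigmaOneOne.exists_continuous {A : Set Reals} {n : ℕ} {S : Set (Fin n → A)}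
    (hS : IsSigmaOneOne S) (hne : S.Nonempty) : ∃ f : (ℕ → ℕ) → Fin n → Reals, Continuous f ∧
      Set.range f = (fun (a : Fin n → A) (i : Fin n) => (a i : Reals)) '' S := by
  rw [IsSigmaOneOne, MeasureTheory.AnalyticSet] at hS
  exact hS.resolve_left (hne.image _).ne_empty

theorem Fin.append_coe {A : Set Reals} {m n : ℕ} (a : Fin m → A) (b : Fin n → A) :
    (fun i => ((Fin.append a b i : A) : Reals)) =
      Fin.append (fun i => (a i : Reals)) fun i => (b i : Reals) :=
  funext fun i => Fin.addCases (fun _ => by simp) (fun _ => by simp) i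

theorem claim7p7 {L : FirstOrder.Language.{u, v}} [Countable L.Symbols]
    (A : Set Reals) [L.Structure A] (Δ : Set (InfFormula L))
    (hcand : IsCandidate A Δ)
    {m : ℕ} (x y : Fin m → ℕ) (φ₀ φ₁ : InfFormula L)
    (hφ₀ : φ₀ ∈ Δ) (hφ₁ : φ₁ ∈ Δ)
    (hvar₀ : φ₀.InVars (Fin.append x y)) (hvar₁ : φ₁.InVars (Fin.append x y))
    (hcontra : Contradictory A φ₀ φ₁ x y)
    {J : Type w} [LinearOrder J] (a : J → Fin m → A)
    (hord : ∀ s t : J, s < t →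
      φ₀.Holds (Fin.append x y) (Fin.append (a s) (a t)) ∧
        φ₁.Holds (Fin.append x y) (Fin.append (a t) (a s)))
    (hJ : ℵ_ (ω_ 1) ≤ #J ∨ (ℵ₀ < #J ∧ orderDensity J < #J)) :
    IsAlephZeroUnstable A Δ ∧
      ∃ (b : List Bool → Fin m → A) (c : (ℕ → Bool) → Fin m → A),
        WitnessesUnstable A Δ x (fun _ => m) (fun _ => y) (fun _ => φ₀) (fun _ => φ₁) b c := by
  suffices h : ∃ (b : List Bool → Fin m → A) (c : (ℕ → Bool) → Fin m → A),
      WitnessesUnstable A Δ x (fun _ => m) (fun _ => y) (fun _ => φ₀) (fun _ => φ₁) b c by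
    obtain ⟨b, c, h⟩ := h
    exact ⟨⟨m, x, _, _, _, _, b, c, h⟩, b, c, h⟩
  obtain ⟨s, t, hst⟩ : ∃ s t : J, s < t := by
    have : Nontrivial J := one_lt_iff_nontrivial.1 <| one_lt_aleph0.trans_le <|
      hJ.elim (fun h => (aleph0_le_aleph _).trans h) fun h => h.1.le
    exact exists_pair_lt J
  obtain ⟨f₀, hf₀, hr₀⟩ := (hcand.analytic φ₀ hφ₀ _ _ hvar₀).exists_continuous
    ⟨_, (hord s t hst).1⟩
  obtain ⟨f₁, hf₁, hr₁⟩ := (hcand.analytic φ₁ hφ₁ _ _ hvar₁).exists_continuous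
    ⟨_, (hord s t hst).2⟩
  obtain ⟨b, c, hbc⟩ := exists_branches hf₀ hf₁ (fun t i => (a t i : Reals))
    (fun s t hst => by
      rw [hr₀, hr₁, ← Fin.append_coe, ← Fin.append_coe]
      exact ⟨⟨_, (hord s t hst).1, rfl⟩, ⟨_, (hord s t hst).2, rfl⟩⟩)
    fun z => exists_splitRank hJ z
  -- The limits stay in the universe because the ranges of `f₀` and `f₁` consist of tuples from `A`.
  have hmem : ∀ η j, (∀ i, c η i ∈ A) ∧ ∀ i, b (PiNat.res η j) i ∈ A := by
    intro η j
    have : ∃ e : Fin (m + m) → A, (fun i => (e i : Reals)) =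
        Fin.append (c η) (b (PiNat.res η j)) := by
      cases h : η j
      · have := (hbc η j).1 h
        rw [hr₀] at this
        exact this.imp fun _ h => h.2
      · have := (hbc η j).2 h
        rw [hr₁] at this
        exact this.imp fun _ h => h.2
    obtain ⟨e, he⟩ := this
    constructor <;> intro i
    · have := congrFun he (Fin.castAdd m i)
      rw [Fin.append_left] at this
      exact this ▸ (e _).2
    · have := congrFun he (Fin.natAdd m i)
      rw [Fin.append_right] at this
      exact this ▸ (e _).2
  -- `IsInitialSegment` reads `ν` forwards while `res` is reversed; padding `ν` to a branch converts
  -- between them.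
  let pad (ν : List Bool) (i : ℕ) : Bool := ν.getD i false
  let b' (ν : List Bool) (i : Fin m) : A :=
    ⟨b (PiNat.res (pad ν) ν.length) i, (hmem (pad ν) ν.length).2 i⟩
  let c' (η : ℕ → Bool) (i : Fin m) : A := ⟨c η i, (hmem η 0).1 i⟩
  have hres : ∀ ν η, IsInitialSegment ν η →
      PiNat.res (pad ν) ν.length = PiNat.res η ν.length := fun ν η h =>
    PiNat.res_eq_res.2 fun i hi => by
      rw [← h i hi]
      exact List.getD_eq_getElem _ _ hi
  have hinj : Function.Injective fun (a : Fin (m + m) → A) (i : Fin (m + m)) => (a i : Reals) :=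
    fun e e' h => funext fun i => Subtype.ext (congrFun h i)
  refine ⟨b', c', fun _ => hφ₀, fun _ => hφ₁, fun _ => hvar₀, fun _ => hvar₁,
    fun ν ⟨e, he⟩ => hcontra ⟨e, b' ν, he⟩, fun ν η₀ η₁ h₀ h₁ hη₀ hη₁ => ⟨?_, ?_⟩⟩
  · have h := (hbc η₀ ν.length).1 hη₀
    rw [hr₀, ← hres ν η₀ h₀] at h
    obtain ⟨e, he, heq⟩ := h
    have : e = Fin.append (c' η₀) (b' ν) :=
      hinj (heq.trans (Fin.append_coe (c' η₀) (b' ν)).symm)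
    exact this ▸ he
  · have h := (hbc η₁ ν.length).2 hη₁
    rw [hr₁, ← hres ν η₁ h₁] at h
    obtain ⟨e, he, heq⟩ := h
    have : e = Fin.append (c' η₁) (b' ν) :=
      hinj (heq.trans (Fin.append_coe (c' η₁) (b' ν)).symm)
    exact this ▸ he
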